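/- Let $d,N\ge 1$ and let $H(\mathbf z)=\sum_{\mathbf n\in\mathbb Z^d} z_1^{n_1}\cdots z_d^{n_d}\,T_{\mathbf n}$ be a finite-range $N$-band Hamiltonian, i.e. $T_{\mathbf n}\in\mathbb C^{N\times N}$ and only finitely many $T_{\mathbf n}$ are nonzero. Put $\mathcal M=\{(\mathbf z,E): z_i\neq 0 \text{ for all } i,\ \det(E-H(\mathbf z))=0\}\subset\mathbb C^d\times\mathbb C$, let $\mathrm{BZ}\subset\mathcal M$ be the set of points with $|z_i|=1$ for all $i$, and let $\Sigma_{\mathrm{PBC}}=\{E : (\mathbf z,E)\in \mathrm{BZ}\}$. A saddle point is a point $(\mathbf z_s,E_s)\in\mathcal M$ at which $\partial_{z_i}\det(E_s-H(\mathbf z))|_{\mathbf z=\mathbf z_s}=0$ for all $i$. Let $h=\operatorname{Im}E$. Where $\partial_E\det(E-H(\mathbf z))\ne0$, $E$ is locally a holomorphic function of $\mathbf z$ on $\mathcal M$, and $\nabla h$ denotes the gradient of $h$ in the real coordinates $\operatorname{Re}z_i,\operatorname{Im}z_i$. An ascending flow line is a curve on $\mathcal M$, through such points with $\nabla h\neq0$,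 that solves $\dot{\mathbf z}=\nabla h/|\nabla h|^2$. The ascending manifold of a saddle point consists of the saddle point and of all points on ascending flow lines that emanate from it. It is parametrized by points $P(t,\boldsymbol\xi)$, where $\boldsymbol\xi\in S^{d-1}$ labels the flow lines and $t>0$ is the flow time ($P\to(\mathbf z_s,E_s)$ as $t\to0$): $t\boldsymbol\xi\mapsto P(t,\boldsymbol\xi)$ is a continuous bijection from an open neighbourhood of $0\in\mathbb R^d$, star-shaped about $0$, onto the ascending manifold, and a smooth immersion away from $0$. Write $\boldsymbol\mu(t,\boldsymbol\xi)=(\log|z_1|,\dots,\log|z_d|)$ at $P(t,\boldsymbol\xi)$, so that $\boldsymbol\mu=0$ exactly where the ascending manifold hits the BZ. The saddle point is relevant for the BZ integral if it has such a parametrization and its weight, the signed number of hits of the BZ by its ascending manifold, is nonzero. That is, at least one of the following holds: (a) the saddle point does not lie on the BZ, there are finitely many hits, all with $\det\frac{\partial\boldsymbol\mu}{\partial(t,\boldsymbol\xi)}\ne0$, and $\sum_{\text{hits}}\operatorname{sgn}\det\frac{\partial\boldsymbol\mu}{\partial(t,\boldsymbol\xi)}\neq0$; (b) for some $t>0$ up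 to which all flow lines exist and with $\operatorname{Im}E_s+t>\max\operatorname{Im}\Sigma_{\mathrm{PBC}}$, the winding number around the origin of $\boldsymbol\xi\mapsto\boldsymbol\mu(t,\boldsymbol\xi)$ is nonzero. With $\hat{\boldsymbol\mu}=\boldsymbol\mu/\|\boldsymbol\mu\|$ and $A_{d-1}$ the area of $S^{d-1}$, this number is $\frac1{A_{d-1}}\int_{S^{d-1}}\det(\hat{\boldsymbol\mu},\partial_1\hat{\boldsymbol\mu},\dots,\partial_{d-1}\hat{\boldsymbol\mu})\,\mathrm d\boldsymbol\xi$, with the derivatives taken in an oriented orthonormal tangent frame; for $d=1$ it is $\tfrac12(\operatorname{sgn}\mu(t,+1)-\operatorname{sgn}\mu(t,-1))$. Then: 1. If a saddle point $(\mathbf z_s,E_s)$ is relevant, then $E_s+it\in\Sigma_{\mathrm{PBC}}$ for at least one real $t\ge0$. 2. $\max_{E\in\Sigma_{\mathrm{PBC}}}\operatorname{Im}E$ exists, and every relevant saddle point satisfies $\operatorname{Im}E_s\le\max_{E\in\Sigma_{\mathrm{PBC}}}\operatorname{Im}E$. -/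

import Mathlib

open scoped ContDiff

noncomputable section

namespace LatticeModel

/-- A finite-range hopping model with `N` bands on `ℤ^d`: finitely many nonzero `N × N` hopping
matrices, indexed by the hopping vector. -/
abbrev Hopping (d N : ℕ) : Type := (Fin d → ℤ) →₀ Matrix (Fin N) (Fin N) ℂ

/-- Points `(z, E)` of `ℂ^d × ℂ`. -/
abbrev Pt (d : ℕ) : Type := (Fin d → ℂ) × ℂ

/-- Real `d`-space with the Euclidean norm; it carries the polar coordinates `x = t • ξ`
(`t > 0`, `‖ξ‖ = 1`) of ascending manifolds, and the vectors `μ`. -/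
abbrev Eucl (d : ℕ) : Type := EuclideanSpace ℝ (Fin d)

variable {d N : ℕ}

/-- The Hamiltonian `H(z) = ∑ₙ z₁^n₁ ⋯ z_d^n_d Tₙ`, a matrix of Laurent polynomials. -/
def hamiltonian (T : Hopping d N) (z : Fin d → ℂ) : Matrix (Fin N) (Fin N) ℂ :=
  T.sum fun n A => (∏ i, z i ^ n i) • A

/-- `det (E - H(z))`. -/
def charDet (T : Hopping d N) (P : Pt d) : ℂ :=
  (P.2 • (1 : Matrix (Fin N) (Fin N) ℂ) - hamiltonian T P.1).det

/-- The energy surface `𝓜 = {(z, E) | det (E - H(z)) = 0, all z_i ≠ 0}`. -/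
def energySurface (T : Hopping d N) : Set (Pt d) :=
  {P | (∀ i, P.1 i ≠ 0) ∧ charDet T P = 0}

/-- The (multi-band) Brillouin zone: the points of `𝓜` with `|z_i| = 1` for all `i`. -/
def brillouinZone (T : Hopping d N) : Set (Pt d) :=
  {P | P ∈ energySurface T ∧ ∀ i, ‖P.1 i‖ = 1}

/-- The PBC spectrum `Σ_PBC = E(BZ)`. -/
def pbcSpectrum (T : Hopping d N) : Set ℂ :=
  Prod.snd '' brillouinZone T

/-- `∂/∂z_i det (E - H(z))`. -/
def charDetDz (T : Hopping d N) (P : Pt d) (i : Fin d) : ℂ :=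
  deriv (fun w : ℂ => charDet T (Function.update P.1 i w, P.2)) (P.1 i)

/-- `∂/∂E det (E - H(z))`. -/
def charDetDE (T : Hopping d N) (P : Pt d) : ℂ :=
  deriv (fun e : ℂ => charDet T (P.1, e)) P.2

/-- A saddle point `(z_s, E_s)`: `det (E_s - H(z_s)) = 0` and `∂_z det (E_s - H(z)) = 0` at `z_s`. -/
def IsSaddlePoint (T : Hopping d N) (P : Pt d) : Prop :=
  P ∈ energySurface T ∧ ∀ i, charDetDz T P i = 0

/-- The derivative `∂E/∂z_i` along `𝓜`, by implicit differentiation of `det (E - H(z)) = 0`;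
meaningful at the points where `∂_E det (E - H(z)) ≠ 0`, near which `E` is a holomorphic
function of `z`. -/
def bandDeriv (T : Hopping d N) (P : Pt d) (i : Fin d) : ℂ :=
  -charDetDz T P i / charDetDE T P

/-- The gradient `∇h` of `h = Im E` with respect to the `2d` real coordinates `Re z_i, Im z_i`,
written as a complex vector. As `dh(v) = Im (∑ ∂_i E v_i) = Re (∑ conj (∇h)_i v_i)`, its
components are `I * conj (∂_i E)`. -/
def gradIm (T : Hopping d N) (P : Pt d) (i : Fin d) : ℂ :=
  Complex.I * (starRingEnd ℂ) (bandDeriv T P i)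

/-- `‖∇h‖²`. -/
def gradImNormSq (T : Hopping d N) (P : Pt d) : ℝ :=
  ∑ i, ‖gradIm T P i‖ ^ 2

/-- `γ` is, on the set `s` of times, an ascending gradient flow line on `𝓜`: it is a
differentiable curve in `𝓜`, through points near which `E` is a function of `z` and `∇h ≠ 0`,
with `dz/dt = ∇h / ‖∇h‖²`. -/
def IsAscendingFlowLine (T : Hopping d N) (γ : ℝ → Pt d) (s : Set ℝ) : Prop :=
  ∀ t ∈ s, γ t ∈ energySurface T ∧ charDetDE T (γ t) ≠ 0 ∧ gradImNormSq T (γ t) ≠ 0 ∧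
    DifferentiableAt ℝ (fun u => (γ u).2) t ∧
    HasDerivAt (fun u => (γ u).1)
      (fun i => gradIm T (γ t) i / (gradImNormSq T (γ t) : ℂ)) t

/-- The ascending manifold of `P`: the point `P`, and all points on ascending flow lines that
emanate from `P`. -/
def ascendingManifold (T : Hopping d N) (P : Pt d) : Set (Pt d) :=
  {Q | Q = P ∨ ∃ (γ : ℝ → Pt d) (a s : ℝ), 0 < s ∧ s < a ∧
    IsAscendingFlowLine T γ (Set.Ioo 0 a) ∧
    Filter.Tendsto γ (nhdsWithin 0 (Set.Ioi 0)) (nhds P) ∧ γ s = Q}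

/-- A parametrization `P(t, ξ) = toFun (t • ξ)` of the whole ascending manifold of `P` by the flow
time `t` and the label `ξ ∈ S^{d-1}` of the flow line. The flow line of `ξ` exists for the times
`t` with `t • ξ ∈ domain`; it may have a finite life time. -/
structure AscendingParam (T : Hopping d N) (P : Pt d) where
  domain : Set (Eucl d)
  toFun : Eucl d → Pt d
  isOpen_domain : IsOpen domain
  zero_mem : (0 : Eucl d) ∈ domain
  starConvex_domain : StarConvex ℝ 0 domain
  map_zero : toFun 0 = P
  continuousOn : ContinuousOn toFun domain
  smooth : ContDiffOn ℝ ∞ toFun (domain \ {0})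
  immersion : ∀ x ∈ domain \ {0}, Function.Injective (fderiv ℝ toFun x)
  flowLine : ∀ ξ : Eucl d, ‖ξ‖ = 1 →
    IsAscendingFlowLine T (fun t => toFun (t • ξ)) {t | 0 < t ∧ t • ξ ∈ domain}
  injOn : Set.InjOn toFun domain
  image_eq : toFun '' domain = ascendingManifold T P

/-- `μ_i = log |z_i|`; on `𝓜`, the Brillouin zone is the set `μ = 0`. -/
def logModulus (P : Pt d) : Eucl d :=
  WithLp.toLp 2 fun i => Real.log ‖P.1 i‖

/-- The extension of `ξ ↦ F ξ / ‖F ξ‖`, from the unit sphere, which is homogeneous of degree one. -/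
def conicalExtension (F : Eucl d → Eucl d) (x : Eucl d) : Eucl d :=
  (‖x‖ * ‖F (‖x‖⁻¹ • x)‖⁻¹) • F (‖x‖⁻¹ • x)

/-- The winding number around the origin of the restriction of `F` to `S^{d-1}`,
`(1 / A_{d-1}) ∫_{S^{d-1}} det (F̂, ∂₁ F̂, …, ∂_{d-1} F̂)` with `F̂ = F / ‖F‖`.
In an orthonormal frame `ξ, e₁, …, e_{d-1}` at `ξ ∈ S^{d-1}` the columns of the derivative of
`conicalExtension F` are `F̂, ∂₁ F̂, …, ∂_{d-1} F̂`. For `d = 1` the value is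
`(sgn F(1) - sgn F(-1)) / 2`. -/
def windingNumber (F : Eucl d → Eucl d) : ℝ :=
  ((MeasureTheory.volume : MeasureTheory.Measure (Eucl d)).toSphere.real Set.univ)⁻¹ *
    ∫ ξ : Metric.sphere (0 : Eucl d) 1, (fderiv ℝ (conicalExtension F) (ξ : Eucl d)).det
      ∂(MeasureTheory.volume : MeasureTheory.Measure (Eucl d)).toSphere

namespace AscendingParam

variable {T : Hopping d N} {P : Pt d}

/-- `μ` as a function on the parameter space. -/
def mu (A : AscendingParam T P) (x : Eucl d) : Eucl d :=
  logModulus (A.toFun x)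

/-- The parameters at which the ascending manifold hits the Brillouin zone. -/
def hits (A : AscendingParam T P) : Set (Eucl d) :=
  {x | x ∈ A.domain ∧ A.toFun x ∈ brillouinZone T}

/-- The weight of the saddle point as the sum of the orientations `sgn det ∂μ/∂(t, ξ)` over all
hits of the Brillouin zone by the ascending flow. -/
def hitWeight (A : AscendingParam T P) : ℤ :=
  ∑ᶠ x ∈ A.hits, (SignType.sign (fderiv ℝ A.mu x).det : ℤ)

/-- The hits are finitely many and transversal, and the saddle point itself is not one of them. -/
def HasRegularHits (A : AscendingParam T P) : Prop :=
  P ∉ brillouinZone T ∧ A.hits.Finite ∧ ∀ x ∈ A.hits, (fderiv ℝ A.mu x).det ≠ 0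

/-- The winding number `w(t)` of `ξ ↦ μ(t, ξ)` around the origin. -/
def windingAt (A : AscendingParam T P) (t : ℝ) : ℝ :=
  windingNumber fun ξ => A.mu (t • ξ)

/-- All ascending flow lines exist up to time `t`, and at time `t` they have passed the level
`max_BZ Im E`, so that they meet the Brillouin zone neither at time `t` nor later. -/
def IsFinalTime (A : AscendingParam T P) (t : ℝ) : Prop :=
  0 < t ∧ Metric.closedBall 0 t ⊆ A.domain ∧ ∀ E ∈ pbcSpectrum T, E.im < P.2.im + t

end AscendingParam

/-- `P` is relevant: it has nonzero weight, that is, the signed number of hits of the Brillouin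
zone by its ascending manifold is nonzero, where the weight is computed either as the sum of the
orientations of the hits, or as the winding number of `μ(t, ·)` at late `t`.
(If all flow lines live forever, the latter is `lim_{t → ∞} w(t) ≠ 0`. The choice of the
parametrization affects only the overall sign of the weight.) -/
def IsRelevant (T : Hopping d N) (P : Pt d) : Prop :=
  ∃ A : AscendingParam T P,
    (A.HasRegularHits ∧ A.hitWeight ≠ 0) ∨ ∃ t, A.IsFinalTime t ∧ A.windingAt t ≠ 0

end LatticeModel

end

/-! Along an ascending flow line `E` is holomorphic in `z`, so `dE/dt = ∑ ∂_i E · (∇h)_i / |∇h|² =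
i`. Hence the point with parameter `x` has energy exactly `E_s + i‖x‖` (`energy_eq`), and any hit of
the Brillouin zone puts `E_s + it`, `t = ‖x‖ ≥ 0`, into the PBC spectrum. The bound on `Im E_s`
follows because the Brillouin zone is compact and nonempty.

What remains is that nonzero weight forces a hit (`IsRelevant.exists_hit`). A signed count over no
hits is zero. For the winding number, absence of hits makes `μ` a nonvanishing map of a ball, and
the Kronecker integral of its boundary values must vanish. The integral equals, up to a factor, the
integral over the unit ball of the Jacobian of a conical Lipschitz map. The Jacobian is a null
Lagrangian (`integral_det_fderiv_eq_of_eqOn_compl`), so that map may be replaced inside the ball by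
the normalized extension, whose values are unit vectors and whose Jacobian is therefore zero.

The null Lagrangian property is obtained for Lipschitz maps without smoothing: for large `c` the map
`c • id + G` is a bijection with positive Jacobian, so the integral of this Jacobian is the volume
of an image, which depends only on `G` off the set. Interpolation in `c` then recovers `det DG`. -/

noncomputable section

namespace LatticeModel

open MeasureTheory Set Filter Topology Metric
open scoped NNReal

/-! ### Jacobian determinants of Lipschitz maps -/

section DegreeTheory

variable {F : Type*} [NormedAddCommGroup F] [NormedSpace ℝ F] [FiniteDimensional ℝ F]

/-- The determinant of `A` is a fixed linear combination of the determinants of `c + A`, for any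
`finrank + 1` shifts `c`. -/
theorem det_eq_sum_det_shift (c : ℝ) :
    ∃ w : ℕ → ℝ, ∀ A : F →L[ℝ] F, A.det =
      ∑ j ∈ Finset.range (Module.finrank ℝ F + 1),
        w j * ((c + j) • ContinuousLinearMap.id ℝ F + A).det := by
  classical
  set s := Finset.range (Module.finrank ℝ F + 1)
  set v : ℕ → ℝ := fun j => c + j
  have hv : InjOn v s := fun i _ j _ h => by simpa [v] using h
  -- `r ↦ det (r + A)` is the characteristic polynomial of `-A`, of degree `finrank`; its value at
  -- `0` is thus interpolated from the `finrank + 1` nodes `c + j`, with weights independent of `A`.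
  refine ⟨fun j => (Lagrange.basis s v j).eval 0, fun A => ?_⟩
  have hev : ∀ r : ℝ, (-(A : F →ₗ[ℝ] F)).charpoly.eval r =
      (r • ContinuousLinearMap.id ℝ F + A).det := by
    intro r
    rw [LinearMap.eval_charpoly, ContinuousLinearMap.det]
    congr 1
    ext x
    simp [Algebra.algebraMap_eq_smul_one]
  have hdeg : (-(A : F →ₗ[ℝ] F)).charpoly.degree < s.card := by
    rw [Polynomial.degree_eq_natDegree (LinearMap.charpoly_monic _).ne_zero,
      LinearMap.charpoly_natDegree]
    simp only [s, Finset.card_range]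
    exact_mod_cast Nat.lt_succ_self _
  have h := congrArg (Polynomial.eval 0) (Lagrange.eq_interpolate hv hdeg)
  rw [hev, Lagrange.interpolate_apply, Polynomial.eval_finsetSum] at h
  simp only [zero_smul, zero_add, Polynomial.eval_mul, Polynomial.eval_C] at h
  rw [h]
  refine Finset.sum_congr rfl fun j _ => ?_
  rw [hev, mul_comm]

/-- Deform `A` to `0` through `s • A`. A kernel vector `x` would give `c‖x‖ = s‖A x‖ ≤ ‖A‖‖x‖`, so
the determinant never vanishes and keeps the sign of `c ^ finrank`. -/
theorem det_smul_id_add_pos {c : ℝ} {A : F →L[ℝ] F} (h : ‖A‖ < c) :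
    0 < (c • ContinuousLinearMap.id ℝ F + A).det := by
  have hc : 0 < c := (norm_nonneg _).trans_lt h
  let f : ℝ → ℝ := fun s => (c • ContinuousLinearMap.id ℝ F + s • A).det
  have hf : Continuous f := by
    refine ContinuousLinearMap.continuous_det.comp ?_
    fun_prop
  have hne : ∀ s ∈ Icc (0 : ℝ) 1, f s ≠ 0 := by
    intro s hs h0
    have h0' : LinearMap.det ((c • ContinuousLinearMap.id ℝ F + s • A : F →L[ℝ] F) :
        F →ₗ[ℝ] F) = 0 := h0
    obtain ⟨x, hx, hx0⟩ := (Submodule.ne_bot_iff _).1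
      (bot_lt_iff_ne_bot.1 (LinearMap.bot_lt_ker_of_det_eq_zero h0'))
    have hx' : c • x = -(s • A x) := by
      have : c • x + s • A x = 0 := by simpa using hx
      exact eq_neg_of_add_eq_zero_left this
    have hn := congrArg norm hx'
    rw [norm_neg, norm_smul, norm_smul, Real.norm_of_nonneg hc.le, Real.norm_of_nonneg hs.1] at hn
    have h1 : s * ‖A x‖ ≤ ‖A‖ * ‖x‖ :=
      (mul_le_of_le_one_left (norm_nonneg _) hs.2).trans (A.le_opNorm x)
    have h2 : 0 < ‖x‖ := norm_pos_iff.2 hx0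
    nlinarith
  have h0 : 0 < f 0 := by
    have : f 0 = c ^ Module.finrank ℝ F := by
      simp only [f, zero_smul, add_zero, ContinuousLinearMap.det]
      simp
    rw [this]
    positivity
  have h1 : 0 < f 1 := by
    by_contra hcon
    obtain ⟨s, hs, hs0⟩ := intermediate_value_Icc' (zero_le_one' ℝ) hf.continuousOn
      (show (0 : ℝ) ∈ Icc (f 1) (f 0) from ⟨not_lt.1 hcon, h0.le⟩)
    exact hne s hs hs0
  simpa [f] using h1

/-- A large multiple of the identity plus a Lipschitz map is a bijection. -/
theorem bijective_smul_id_add {K : ℝ≥0} {G : F → F} (hG : LipschitzWith K G) {c : ℝ}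
    (hc : (K : ℝ) < c) : Function.Bijective fun x => c • x + G x := by
  have hc0 : 0 < c := K.2.trans_lt hc
  let e : F ≃L[ℝ] F := ContinuousLinearEquiv.smulLeft (Units.mk0 c hc0.ne')
  have happ : ApproximatesLinearOn (fun x => c • x + G x) (e : F →L[ℝ] F) univ K := by
    intro x _ y _
    have : c • x + G x - (c • y + G y) - (e : F →L[ℝ] F) (x - y) = G x - G y := by
      have : (e : F →L[ℝ] F) (x - y) = c • (x - y) := rfl
      rw [this, smul_sub]; abel
    rw [this]
    exact hG.norm_sub_le x y
  -- `‖e⁻¹‖ ≤ 1 / c < 1 / K`. The trivial space is set apart since there `‖e⁻¹‖⁻¹` is the default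
  -- value `0`.
  have hlt : Subsingleton F ∨ K < ‖(e.symm : F →L[ℝ] F)‖₊⁻¹ := by
    rcases subsingleton_or_nontrivial F with hF | hF
    · exact Or.inl hF
    · right
      have hle : ‖(e.symm : F →L[ℝ] F)‖₊ ≤ ‖c‖₊⁻¹ := by
        rw [← NNReal.coe_le_coe]
        refine ContinuousLinearMap.opNorm_le_bound _ (NNReal.coe_nonneg _) fun x => ?_
        have : (e.symm : F →L[ℝ] F) x = c⁻¹ • x := rfl
        rw [this, norm_smul, norm_inv]
        rfl
      have hpos : 0 < ‖(e.symm : F →L[ℝ] F)‖₊ := e.symm.norm_pos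
      refine lt_of_lt_of_le ?_ (inv_anti₀ hpos hle)
      rw [inv_inv, ← NNReal.coe_lt_coe, coe_nnnorm, Real.norm_of_nonneg hc0.le]
      exact hc
  exact ⟨injOn_univ.1 (happ.injOn hlt), happ.surjective hlt⟩

variable [MeasurableSpace F] [BorelSpace F]

theorem _root_.LipschitzWith.addHaar_image_eq_zero {μ : Measure F} [μ.IsAddHaarMeasure] {K : ℝ≥0}
    {f : F → F} (hf : LipschitzWith K f) {s : Set F} (hs : μ s = 0) : μ (f '' s) = 0 := by
  have h1 : μH[Module.finrank ℝ F] s = 0 :=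
    Measure.absolutelyContinuous_isAddHaarMeasure (μH[Module.finrank ℝ F]) μ hs
  have h2 : (μH[Module.finrank ℝ F] : Measure F) (f '' s) = 0 := by
    refine le_antisymm ((hf.hausdorffMeasure_image_le (Nat.cast_nonneg _) s).trans ?_) zero_le
    rw [h1, mul_zero]
  exact Measure.absolutelyContinuous_isAddHaarMeasure μ (μH[Module.finrank ℝ F]) h2

variable {μ : Measure F} [μ.IsAddHaarMeasure]

/-- Change of variables for an injective map, where positivity of the Jacobian removes the absolute
value. By Rademacher's theorem the derivative exists almost everywhere. -/
theorem integral_det_smul_id_add_eq_measure_image {K : ℝ≥0} {G : F → F} (hG : LipschitzWith K G)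
    {c : ℝ} (hc : (K : ℝ) < c) {B : Set F} (hB : MeasurableSet B) (hBb : Bornology.IsBounded B) :
    IntegrableOn (fun x => (c • ContinuousLinearMap.id ℝ F + fderiv ℝ G x).det) B μ ∧
    ∫ x in B, (c • ContinuousLinearMap.id ℝ F + fderiv ℝ G x).det ∂μ =
      μ.real ((fun x => c • x + G x) '' B) := by
  set f : F → F := fun x => c • x + G x
  set D : Set F := {x | DifferentiableAt ℝ G x}
  have hD : MeasurableSet D := measurableSet_of_differentiableAt ℝ G
  have hDc : μ (B \ D) = 0 := by
    have h : μ Dᶜ = 0 := hG.ae_differentiableAt (μ := μ)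
    exact measure_mono_null (fun x hx => hx.2) h
  have hfL : LipschitzWith (‖c‖₊ + K) f := (lipschitzWith_smul c).add hG
  have hBD : (B ∩ D : Set F) =ᵐ[μ] B := by
    rw [ae_eq_set]
    exact ⟨by rw [sdiff_eq_empty.2 inter_subset_left, measure_empty], by rwa [sdiff_self_inter]⟩
  -- Discarding the points of non-differentiability is harmless, as a Lipschitz map sends null sets
  -- to null sets.
  have him : (f '' (B ∩ D) : Set F) =ᵐ[μ] f '' B := by
    rw [ae_eq_set]
    refine ⟨by rw [sdiff_eq_empty.2 (image_mono inter_subset_left), measure_empty], ?_⟩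
    refine measure_mono_null ?_ (hfL.addHaar_image_eq_zero hDc)
    rw [← image_sdiff (bijective_smul_id_add hG hc).1, sdiff_self_inter]
  have hder : ∀ x ∈ B ∩ D, HasFDerivWithinAt f
      (c • ContinuousLinearMap.id ℝ F + fderiv ℝ G x) (B ∩ D) x := fun x hx =>
    (((hasFDerivAt_id x).const_smul c).add hx.2.hasFDerivAt).hasFDerivWithinAt
  have hinj : InjOn f (B ∩ D) := (bijective_smul_id_add hG hc).1.injOn
  have hpos : ∀ x ∈ B ∩ D, 0 < (c • ContinuousLinearMap.id ℝ F + fderiv ℝ G x).det := fun x _ =>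
    det_smul_id_add_pos ((norm_fderiv_le_of_lipschitz ℝ hG).trans_lt hc)
  have hmeas : MeasurableSet (B ∩ D) := hB.inter hD
  have hfin : μ (f '' (B ∩ D)) ≠ ⊤ := by
    refine ((hfL.isBounded_image hBb).subset (image_mono inter_subset_left)).measure_lt_top.ne
  have habs : ∀ x ∈ B ∩ D, |(c • ContinuousLinearMap.id ℝ F + fderiv ℝ G x).det| • (1 : ℝ) =
      (c • ContinuousLinearMap.id ℝ F + fderiv ℝ G x).det := fun x hx => by
    rw [abs_of_pos (hpos x hx), smul_eq_mul, mul_one]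
  have h1 := integrableOn_image_iff_integrableOn_abs_det_fderiv_smul μ hmeas hder hinj
    (fun _ => (1 : ℝ))
  have h2 := integral_image_eq_integral_abs_det_fderiv_smul μ hmeas hder hinj (fun _ => (1 : ℝ))
  rw [integrableOn_congr_fun habs hmeas, integrableOn_congr_set_ae hBD] at h1
  rw [setIntegral_congr_fun hmeas habs, setIntegral_congr_set hBD, setIntegral_congr_set him] at h2
  refine ⟨h1.1 (integrableOn_const hfin), ?_⟩
  rw [← h2, setIntegral_const, smul_eq_mul, mul_one]

/-- The Jacobian determinant is a null Lagrangian: its integral over a bounded set is the same for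
two Lipschitz maps that agree off this set. -/
theorem integral_det_fderiv_eq_of_eqOn_compl {K₁ K₂ : ℝ≥0} {G₁ G₂ : F → F}
    (h₁ : LipschitzWith K₁ G₁) (h₂ : LipschitzWith K₂ G₂) {B : Set F} (hB : MeasurableSet B)
    (hBb : Bornology.IsBounded B) (heq : EqOn G₁ G₂ Bᶜ) :
    ∫ x in B, (fderiv ℝ G₁ x).det ∂μ = ∫ x in B, (fderiv ℝ G₂ x).det ∂μ := by
  -- Any `c` above both Lipschitz constants works; then every shift `c + j` does too.
  obtain ⟨c, hc⟩ : ∃ c : ℝ, c = K₁ + K₂ + 1 := ⟨_, rfl⟩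
  have hc₁ : ∀ j : ℕ, (K₁ : ℝ) < c + j := fun j => by
    have : (0 : ℝ) ≤ j := j.cast_nonneg
    linarith [K₂.coe_nonneg]
  have hc₂ : ∀ j : ℕ, (K₂ : ℝ) < c + j := fun j => by
    have : (0 : ℝ) ≤ j := j.cast_nonneg
    linarith [K₁.coe_nonneg]
  obtain ⟨w, hw⟩ := det_eq_sum_det_shift (F := F) c
  -- For a bijection the image of `B` is the complement of the image of `Bᶜ`, where the two maps
  -- coincide.
  have himage : ∀ j : ℕ, (fun x => (c + j) • x + G₁ x) '' B = (fun x => (c + j) • x + G₂ x) '' B := by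
    intro j
    rw [← compl_inj_iff, ← image_compl_eq (bijective_smul_id_add h₁ (hc₁ j)),
      ← image_compl_eq (bijective_smul_id_add h₂ (hc₂ j))]
    refine image_congr fun x hx => ?_
    rw [heq hx]
  rw [integral_congr_ae (Eventually.of_forall fun x => hw (fderiv ℝ G₁ x)),
    integral_congr_ae (Eventually.of_forall fun x => hw (fderiv ℝ G₂ x)),
    integral_finsetSum _ fun j _ =>
      (integral_det_smul_id_add_eq_measure_image h₁ (hc₁ j) hB hBb).1.const_mul _,
    integral_finsetSum _ fun j _ =>
      (integral_det_smul_id_add_eq_measure_image h₂ (hc₂ j) hB hBb).1.const_mul _]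
  refine Finset.sum_congr rfl fun j _ => ?_
  rw [integral_const_mul, integral_const_mul,
    (integral_det_smul_id_add_eq_measure_image h₁ (hc₁ j) hB hBb).2,
    (integral_det_smul_id_add_eq_measure_image h₂ (hc₂ j) hB hBb).2, himage]

end DegreeTheory

/-! ### Vanishing of the winding number of maps that extend to the ball -/

/-- The extension `x ↦ m(x) u(x / m(x))` of a bounded Lipschitz map on the unit ball is Lipschitz,
for a Lipschitz gauge `m ≥ ‖·‖`. -/
theorem lipschitzWith_gauge_smul {F : Type*} [NormedAddCommGroup F] [NormedSpace ℝ F] {L : ℝ≥0}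
    {u : F → F} {m : F → ℝ} (hu : LipschitzOnWith L u (closedBall 0 1))
    (hu1 : ∀ x ∈ closedBall (0 : F) 1, ‖u x‖ ≤ 1) (hm : LipschitzWith 1 m) (hmx : ∀ x, ‖x‖ ≤ m x) :
    LipschitzWith (1 + 2 * L) fun x => m x • u ((m x)⁻¹ • x) := by
  have hm0 : ∀ x, 0 ≤ m x := fun x => (norm_nonneg x).trans (hmx x)
  have hp : ∀ x, (m x)⁻¹ • x ∈ closedBall (0 : F) 1 := fun x => by
    rw [mem_closedBall_zero_iff, norm_smul, norm_inv, Real.norm_of_nonneg (hm0 x), mul_comm,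
      ← div_eq_mul_inv]
    exact div_le_one_of_le₀ (hmx x) (hm0 x)
  have hp1 : ∀ x, ‖(m x)⁻¹ • x‖ ≤ 1 := fun x => mem_closedBall_zero_iff.1 (hp x)
  have hmp : ∀ x, m x • (m x)⁻¹ • x = x := fun x => by
    rcases eq_or_ne (m x) 0 with h | h
    · have : x = 0 := norm_le_zero_iff.1 (h ▸ hmx x)
      simp [this]
    · exact smul_inv_smul₀ h x
  have hmd : ∀ x y, |m x - m y| ≤ ‖x - y‖ := fun x y => by
    simpa using hm.norm_sub_le x y
  refine LipschitzWith.of_dist_le_mul fun x y => ?_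
  rw [dist_eq_norm, dist_eq_norm]
  have h1 : m x • u ((m x)⁻¹ • x) - m y • u ((m y)⁻¹ • y) =
      (m x - m y) • u ((m x)⁻¹ • x) + m y • (u ((m x)⁻¹ • x) - u ((m y)⁻¹ • y)) := by
    module
  have h2 : ‖(m x - m y) • u ((m x)⁻¹ • x)‖ ≤ ‖x - y‖ := by
    rw [norm_smul]
    exact (mul_le_of_le_one_right (norm_nonneg _) (hu1 _ (hp x))).trans (hmd x y)
  have h3 : m y * ‖(m x)⁻¹ • x - (m y)⁻¹ • y‖ ≤ 2 * ‖x - y‖ := by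
    have : m y • ((m x)⁻¹ • x - (m y)⁻¹ • y) = (m y - m x) • (m x)⁻¹ • x + (x - y) := by
      rw [smul_sub, hmp y, sub_smul, hmp x]
      abel
    have hn : m y * ‖(m x)⁻¹ • x - (m y)⁻¹ • y‖ = ‖m y • ((m x)⁻¹ • x - (m y)⁻¹ • y)‖ := by
      rw [norm_smul, Real.norm_of_nonneg (hm0 y)]
    rw [hn, this]
    refine (norm_add_le _ _).trans ?_
    have : ‖(m y - m x) • (m x)⁻¹ • x‖ ≤ ‖x - y‖ := by
      rw [norm_smul, norm_sub_rev]
      exact (mul_le_of_le_one_right (norm_nonneg _) (hp1 x)).trans (hmd x y)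
    linarith
  have h4 : ‖m y • (u ((m x)⁻¹ • x) - u ((m y)⁻¹ • y))‖ ≤ L * (2 * ‖x - y‖) := by
    rw [norm_smul, Real.norm_of_nonneg (hm0 y)]
    calc m y * ‖u ((m x)⁻¹ • x) - u ((m y)⁻¹ • y)‖
        ≤ m y * (L * ‖(m x)⁻¹ • x - (m y)⁻¹ • y‖) :=
          mul_le_mul_of_nonneg_left (hu.norm_sub_le (hp x) (hp y)) (hm0 y)
      _ = L * (m y * ‖(m x)⁻¹ • x - (m y)⁻¹ • y‖) := by ring
      _ ≤ _ := mul_le_mul_of_nonneg_left h3 L.coe_nonneg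
  rw [h1]
  refine (norm_add_le _ _).trans ?_
  push_cast
  linarith

/-- The derivative of a map of constant norm one is singular. -/
theorem det_fderiv_eq_zero_of_norm_eq_one {F : Type*} [NormedAddCommGroup F]
    [InnerProductSpace ℝ F] [FiniteDimensional ℝ F] {u : F → F} {x : F} (hu : DifferentiableAt ℝ u x)
    (h1 : ∀ᶠ y in 𝓝 x, ‖u y‖ = 1) : (fderiv ℝ u x).det = 0 := by
  by_contra hdet
  have horth : ∀ v, inner ℝ (u x) (fderiv ℝ u x v) = 0 := by
    intro v
    have hc : (fun y => ‖u y‖ ^ 2) =ᶠ[𝓝 x] fun _ => (1 : ℝ) := by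
      filter_upwards [h1] with y hy
      rw [hy, one_pow]
    have h2 := (hasFDerivAt_const (𝕜 := ℝ) (1 : ℝ) x).congr_of_eventuallyEq hc
    have h3 := h2.unique hu.hasFDerivAt.norm_sq
    have h4 := congrArg (fun A : F →L[ℝ] ℝ => A v) h3
    simp at h4
    exact h4
  have hsurj : Function.Surjective (fderiv ℝ u x) :=
    (LinearMap.equivOfDetNeZero _ hdet).surjective
  -- The range of the derivative is orthogonal to `u x`, so it cannot contain this unit vector.
  obtain ⟨v, hv⟩ := hsurj (u x)
  have h0 := horth v
  rw [hv, real_inner_self_eq_norm_sq, h1.self_of_nhds] at h0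
  norm_num at h0

/-- The integral over the sphere of a function that is homogeneous of degree zero. -/
theorem integral_toSphere_of_homogeneous {F : Type*} [NormedAddCommGroup F] [NormedSpace ℝ F]
    [MeasurableSpace F] [BorelSpace F] (μ : Measure F) {f : F → ℝ} (hf : Measurable f)
    (hom : ∀ r : ℝ, 0 < r → ∀ x, f (r • x) = f x) :
    ∫ ξ : sphere (0 : F) 1, f ξ ∂μ.toSphere =
      Module.finrank ℝ F * ∫ x in ball (0 : F) 1 ∩ {0}ᶜ, f x ∂μ := by
  -- Polar coordinates: `toSphere` is by definition `finrank` times the sphere marginal of `μ`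
  -- pulled back to radii below `1`.
  set g : sphere (0 : F) 1 × Ioi (0 : ℝ) → F := Subtype.val ∘ (homeomorphUnitSphereProd F).symm
  have hg : MeasurableEmbedding g :=
    (MeasurableEmbedding.subtype_coe (measurableSet_singleton _).compl).comp
      (Homeomorph.measurableEmbedding _)
  have hgp : ∀ p, g p = (p.2 : ℝ) • (p.1 : F) := fun p => rfl
  have hrange : range g = {0}ᶜ := by
    simp only [g]
    rw [range_comp, (Homeomorph.surjective _).range_eq, image_univ, Subtype.range_coe]
  have hpre : g ⁻¹' ball 0 1 = univ ×ˢ Iio ⟨1, mem_Ioi.2 one_pos⟩ := by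
    ext p
    have hp2 : (0 : ℝ) < p.2 := p.2.2
    simp only [mem_preimage, mem_ball_zero_iff, hgp, norm_smul, Real.norm_of_nonneg hp2.le,
      norm_eq_of_mem_sphere, mul_one, mem_prod, mem_univ, true_and, mem_Iio]
    rfl
  have key : ∫ ξ : sphere (0 : F) 1, f ξ
      ∂((μ.comap g).restrict (univ ×ˢ Iio ⟨1, mem_Ioi.2 one_pos⟩)).fst =
      ∫ x in ball (0 : F) 1 ∩ {0}ᶜ, f x ∂μ := by
    rw [Measure.fst, integral_map (f := fun ξ : sphere (0 : F) 1 => f ξ) measurable_fst.aemeasurable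
      (hf.comp measurable_subtype_coe).aestronglyMeasurable, ← hpre, ← hrange,
      ← Measure.restrict_restrict measurableSet_ball, ← hg.map_comap, hg.setIntegral_map]
    refine integral_congr_ae (Eventually.of_forall fun p => ?_)
    simp only [hgp]
    exact (hom _ p.2.2 _).symm
  rw [Measure.toSphere, ← Nat.cast_smul_eq_nsmul NNReal, integral_smul_nnreal_measure, key]
  rfl

/-- Put `u = M / ‖M‖`. The gauge `‖x‖` yields the conical extension of `f`, while `max 1 ‖x‖` yields
a map that is the same off the unit ball and is `u` inside it. Both are Lipschitz, so their
Jacobians have the same integral over the ball, and that of `u` vanishes pointwise. -/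
theorem windingNumber_eq_zero_of_extension {d : ℕ} {f M : Eucl d → Eucl d}
    (hM : ∀ x ∈ closedBall (0 : Eucl d) 1, ContDiffAt ℝ 1 M x)
    (hM0 : ∀ x ∈ closedBall (0 : Eucl d) 1, M x ≠ 0)
    (hfM : ∀ x ∈ sphere (0 : Eucl d) 1, f x = M x) : windingNumber f = 0 := by
  set u : Eucl d → Eucl d := fun x => ‖M x‖⁻¹ • M x
  have hu1 : ∀ x ∈ closedBall (0 : Eucl d) 1, ‖u x‖ = 1 := fun x hx =>
    norm_smul_inv_norm (𝕜 := ℝ) (hM0 x hx)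
  have huC : ∀ x ∈ closedBall (0 : Eucl d) 1, ContDiffAt ℝ 1 u x := fun x hx =>
    (((hM x hx).norm ℝ (hM0 x hx)).inv (norm_ne_zero_iff.2 (hM0 x hx))).smul (hM x hx)
  obtain ⟨L, hL⟩ := ContDiffOn.exists_lipschitzOnWith
    (fun x hx => (huC x hx).contDiffWithinAt) one_ne_zero (convex_closedBall (0 : Eucl d) 1)
    (isCompact_closedBall 0 1)
  have hG : LipschitzWith (1 + 2 * L) fun x : Eucl d => ‖x‖ • u (‖x‖⁻¹ • x) :=
    lipschitzWith_gauge_smul hL (fun x hx => (hu1 x hx).le) lipschitzWith_one_norm fun x => le_rfl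
  have hV : LipschitzWith (1 + 2 * L) fun x : Eucl d => max 1 ‖x‖ • u ((max 1 ‖x‖)⁻¹ • x) :=
    lipschitzWith_gauge_smul hL (fun x hx => (hu1 x hx).le) (lipschitzWith_one_norm.const_max 1)
      fun x => le_max_right _ _
  have hcon : conicalExtension f = fun x : Eucl d => ‖x‖ • u (‖x‖⁻¹ • x) := by
    funext x
    rcases eq_or_ne x 0 with rfl | hx
    · simp [conicalExtension]
    · have hs : ‖x‖⁻¹ • x ∈ sphere (0 : Eucl d) 1 := by
        rw [mem_sphere_zero_iff_norm]
        exact norm_smul_inv_norm (𝕜 := ℝ) hx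
      simp only [conicalExtension, u, hfM _ hs, mul_smul]
  have hball : ∫ x in ball (0 : Eucl d) 1, (fderiv ℝ (conicalExtension f) x).det = 0 := by
    rw [hcon, integral_det_fderiv_eq_of_eqOn_compl hG hV measurableSet_ball isBounded_ball]
    · refine setIntegral_eq_zero_of_forall_eq_zero fun x hx => ?_
      have hev : (fun x : Eucl d => max 1 ‖x‖ • u ((max 1 ‖x‖)⁻¹ • x)) =ᶠ[𝓝 x] u := by
        filter_upwards [isOpen_ball.mem_nhds hx] with y hy
        rw [max_eq_left (mem_ball_zero_iff.1 hy).le, inv_one, one_smul, one_smul]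
      rw [hev.fderiv_eq]
      refine det_fderiv_eq_zero_of_norm_eq_one
        ((huC x (ball_subset_closedBall hx)).differentiableAt one_ne_zero) ?_
      filter_upwards [isOpen_ball.mem_nhds hx] with y hy
      exact hu1 y (ball_subset_closedBall hy)
    · intro x hx
      have : 1 ≤ ‖x‖ := by simpa using hx
      simp only [max_eq_right this]
  have hmeas : Measurable fun x : Eucl d => (fderiv ℝ (conicalExtension f) x).det :=
    ContinuousLinearMap.continuous_det.measurable.comp (measurable_fderiv ℝ _)
  have hhom : ∀ r : ℝ, 0 < r → ∀ x : Eucl d, (fderiv ℝ (conicalExtension f) (r • x)).det =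
      (fderiv ℝ (conicalExtension f) x).det := by
    intro r hr x
    have hcomp : (fun y => conicalExtension f (r • y)) = r • conicalExtension f := by
      funext y
      have : ‖r • y‖⁻¹ • r • y = ‖y‖⁻¹ • y := by
        rw [norm_smul, Real.norm_of_nonneg hr.le, smul_smul, mul_inv, mul_comm r⁻¹, mul_assoc,
          inv_mul_cancel₀ hr.ne', mul_one]
      simp only [conicalExtension, this, Pi.smul_apply]
      rw [norm_smul, Real.norm_of_nonneg hr.le, smul_smul, mul_assoc]
    have h1 := fderiv_comp_smul (𝕜 := ℝ) (f := conicalExtension f) (x := x) r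
    rw [hcomp, fderiv_const_smul_field] at h1
    rw [smul_right_injective _ hr.ne' h1]
  -- `M 0 ≠ 0` excludes dimension zero, where the origin would not be a null set.
  have : Nontrivial (Eucl d) :=
    ⟨⟨_, _, hM0 0 (mem_closedBall_self zero_le_one)⟩⟩
  have hae : (ball (0 : Eucl d) 1 ∩ {0}ᶜ : Set (Eucl d)) =ᵐ[volume] ball (0 : Eucl d) 1 := by
    rw [ae_eq_set]
    refine ⟨by rw [sdiff_eq_empty.2 inter_subset_left, measure_empty], ?_⟩
    rw [sdiff_self_inter]
    exact measure_mono_null (fun x hx => not_not.1 hx.2) (measure_singleton (0 : Eucl d))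
  rw [windingNumber, integral_toSphere_of_homogeneous _ hmeas hhom, setIntegral_congr_set hae,
    hball, mul_zero, mul_zero]

/-- The winding number of the restriction to the sphere of radius `t` of a continuous nonvanishing
map of the ball, smooth away from the centre, is zero. -/
theorem windingNumber_eq_zero_of_nonvanishing {d : ℕ} {f : Eucl d → Eucl d} {t : ℝ} (ht : 0 < t)
    (hc : ContinuousAt f 0) (hf : ∀ x ∈ closedBall (0 : Eucl d) t, x ≠ 0 → ContDiffAt ℝ 1 f x)
    (hf0 : ∀ x ∈ closedBall (0 : Eucl d) t, f x ≠ 0) : windingNumber (fun ξ => f (t • ξ)) = 0 := by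
  have hmem : ∀ x ∈ closedBall (0 : Eucl d) 1, t • x ∈ closedBall (0 : Eucl d) t := by
    intro x hx
    rw [mem_closedBall_zero_iff] at hx ⊢
    rw [norm_smul, Real.norm_of_nonneg ht.le]
    exact mul_le_of_le_one_right ht.le hx
  have h00 : f 0 ≠ 0 := hf0 0 (mem_closedBall_self ht.le)
  have hct : ContinuousAt (fun x : Eucl d => f (t • x)) 0 := by
    refine ContinuousAt.comp (g := f) ?_ (by fun_prop)
    simpa using hc
  obtain ⟨δ, hδ, hδf⟩ := Metric.continuousAt_iff.1 hct ‖f 0‖ (norm_pos_iff.2 h00)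
  -- `f` need not be differentiable at the centre, so it is blended with the constant `f 0` there.
  -- The outer radius is at most `δ`, where `f (t • x)` stays close to `f 0`, and at most `1`, which
  -- leaves the values on the unit sphere unchanged.
  let χ : ContDiffBump (0 : Eucl d) :=
    ⟨min δ 1 / 2, min δ 1, by positivity, by linarith [show 0 < min δ 1 by positivity]⟩
  have hχ0 : ∀ x : Eucl d, min δ 1 ≤ ‖x‖ → χ x = 0 := fun x hx =>
    χ.zero_of_le_dist (by rwa [dist_zero_right])
  refine windingNumber_eq_zero_of_extension
    (M := fun x => f (t • x) + χ x • (f 0 - f (t • x))) ?_ ?_ ?_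
  · intro x hx
    rcases eq_or_ne x 0 with rfl | hx0
    · refine (contDiffAt_const (c := f 0)).congr_of_eventuallyEq ?_
      filter_upwards [χ.eventuallyEq_one] with y hy
      rw [hy]
      simp
    · have h1 : ContDiffAt ℝ 1 (fun x : Eucl d => f (t • x)) x :=
        ContDiffAt.comp (g := f) x (hf _ (hmem x hx) (smul_ne_zero ht.ne' hx0))
          (contDiff_const_smul t).contDiffAt
      exact h1.add (χ.contDiffAt.smul (contDiffAt_const.sub h1))
  · intro x hx h0
    by_cases hxδ : min δ 1 ≤ ‖x‖
    · rw [hχ0 x hxδ, zero_smul, add_zero] at h0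
      exact hf0 _ (hmem x hx) h0
    · have hd : dist x 0 < δ := by
        rw [dist_zero_right]
        exact (not_le.1 hxδ).trans_le (min_le_left _ _)
      have h1 := hδf hd
      rw [smul_zero, dist_eq_norm] at h1
      -- A zero of the blend would force `‖f 0‖ ≤ ‖f (t • x) - f 0‖`, against the choice of `δ`.
      have h2 : f 0 = -((1 - χ x) • (f (t • x) - f 0)) := by
        have : f (t • x) + χ x • (f 0 - f (t • x)) = f 0 + (1 - χ x) • (f (t • x) - f 0) := by
          module
        rw [this] at h0
        exact eq_neg_of_add_eq_zero_left h0
      have h3 : ‖f 0‖ ≤ ‖f (t • x) - f 0‖ := by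
        conv_lhs => rw [h2]
        rw [norm_neg, norm_smul, Real.norm_of_nonneg (sub_nonneg.2 χ.le_one)]
        exact mul_le_of_le_one_left (norm_nonneg _) (by linarith [χ.nonneg (x := x)])
      exact absurd h1 (not_lt.2 h3)
  · intro x hx
    rw [hχ0 x (by rw [mem_sphere_zero_iff_norm.1 hx]; exact min_le_right _ _), zero_smul, add_zero]

/-! ### The characteristic determinant and the energy along flow lines -/

variable {d N : ℕ}

theorem hamiltonian_apply (T : Hopping d N) (z : Fin d → ℂ) (a b : Fin N) :
    hamiltonian T z a b = ∑ n ∈ T.support, (∏ i, z i ^ n i) * T n a b := by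
  simp [hamiltonian, Finsupp.sum, Matrix.sum_apply]

theorem differentiableAt_hamiltonian_apply (T : Hopping d N) {z : Fin d → ℂ} (hz : ∀ i, z i ≠ 0)
    (a b : Fin N) : DifferentiableAt ℂ (fun z => hamiltonian T z a b) z := by
  simp_rw [hamiltonian_apply]
  refine DifferentiableAt.fun_sum fun n _ => DifferentiableAt.mul_const ?_ _
  have hzpow : ∀ i ∈ Finset.univ, DifferentiableAt ℂ (fun z : Fin d → ℂ => z i ^ n i) z :=
    fun i _ => DifferentiableAt.zpow (differentiableAt_apply i z) (Or.inl (hz i))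
  exact (HasFDerivAt.finsetProd fun i hi => (hzpow i hi).hasFDerivAt).differentiableAt

theorem differentiableAt_charDet (T : Hopping d N) {P : Pt d} (hP : ∀ i, P.1 i ≠ 0) :
    DifferentiableAt ℂ (charDet T) P := by
  have hH : ∀ a b, DifferentiableAt ℂ (fun Q : Pt d => hamiltonian T Q.1 a b) P := fun a b =>
    DifferentiableAt.comp (g := fun z => hamiltonian T z a b) P
      (differentiableAt_hamiltonian_apply T hP a b) differentiableAt_fst
  unfold charDet
  simp_rw [Matrix.det_apply']
  refine DifferentiableAt.fun_sum fun σ _ => DifferentiableAt.const_mul ?_ _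
  exact (HasFDerivAt.finsetProd fun i _ =>
    ((differentiableAt_snd.mul_const _).fun_sub (hH _ _)).hasFDerivAt).differentiableAt

theorem fderiv_charDet_apply (T : Hopping d N) {P : Pt d} (hP : ∀ i, P.1 i ≠ 0) (v : Fin d → ℂ)
    (e : ℂ) : fderiv ℂ (charDet T) P (v, e) =
      ∑ i, charDetDz T P i * v i + charDetDE T P * e := by
  have hf := (differentiableAt_charDet T hP).hasFDerivAt
  have hz : ∀ i, charDetDz T P i = fderiv ℂ (charDet T) P (Pi.single i 1, 0) := by
    intro i
    have h1 : HasDerivAt (fun w : ℂ => (Function.update P.1 i w, P.2)) (Pi.single i (1 : ℂ), 0)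
        (P.1 i) := (hasDerivAt_update P.1 i (P.1 i)).prodMk (hasDerivAt_const _ _)
    exact (hf.comp_hasDerivAt_of_eq (P.1 i) h1 (by simp)).deriv
  have hE : charDetDE T P = fderiv ℂ (charDet T) P (0, 1) := by
    have h1 : HasDerivAt (fun w : ℂ => (P.1, w)) ((0 : Fin d → ℂ), (1 : ℂ)) P.2 :=
      (hasDerivAt_const _ _).prodMk (hasDerivAt_id _)
    exact (hf.comp_hasDerivAt_of_eq P.2 h1 rfl).deriv
  have hdec : (v, e) = ∑ i, v i • ((Pi.single i 1, 0) : Pt d) + e • ((0, 1) : Pt d) := by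
    ext j
    · simp [Prod.fst_sum, Finset.sum_apply, Pi.single_apply]
    · simp [Prod.snd_sum]
  rw [hdec, map_add, map_sum, map_smul, ← hE]
  simp_rw [map_smul, ← hz, smul_eq_mul]
  rw [mul_comm e]
  congr 1
  exact Finset.sum_congr rfl fun i _ => mul_comm _ _

/-- Along ascending flow lines the energy moves upwards with unit speed. -/
theorem IsAscendingFlowLine.hasDerivAt_energy {T : Hopping d N} {γ : ℝ → Pt d} {s : Set ℝ}
    (h : IsAscendingFlowLine T γ s) {t : ℝ} (hs : s ∈ 𝓝 t) :
    HasDerivAt (fun u => (γ u).2) Complex.I t := by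
  obtain ⟨hsurf, hDE, hgrad, hdiff, hder⟩ := h t (mem_of_mem_nhds hs)
  have hf := ((differentiableAt_charDet T hsurf.1).hasFDerivAt).restrictScalars ℝ
  have hcomp := hf.comp_hasDerivAt t (hder.prodMk hdiff.hasDerivAt)
  -- Differentiating `det (E - H) = 0` along the curve gives a linear equation for `dE/dt`, solvable
  -- since `∂_E det ≠ 0`.
  have hzero : (charDet T ∘ fun u => ((γ u).1, (γ u).2)) =ᶠ[𝓝 t] fun _ => 0 := by
    filter_upwards [hs] with u hu
    exact (h u hu).1.2
  have h0 := hcomp.unique (hzero.hasDerivAt_iff.2 (hasDerivAt_const t (0 : ℂ)))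
  rw [ContinuousLinearMap.coe_restrictScalars', fderiv_charDet_apply T hsurf.1] at h0
  have hsum : ∑ i, charDetDz T (γ t) i * (gradIm T (γ t) i / (gradImNormSq T (γ t) : ℂ)) =
      -(charDetDE T (γ t) * Complex.I) := by
    have h1 : ∀ i, charDetDz T (γ t) i * (gradIm T (γ t) i / (gradImNormSq T (γ t) : ℂ)) =
        -(charDetDE T (γ t) * Complex.I / (gradImNormSq T (γ t) : ℂ)) *
          ((‖gradIm T (γ t) i‖ ^ 2 : ℝ) : ℂ) := by
      intro i
      have h2 : charDetDz T (γ t) i = -(charDetDE T (γ t) * bandDeriv T (γ t) i) := by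
        rw [bandDeriv]
        field_simp
      have h3 : ((‖gradIm T (γ t) i‖ ^ 2 : ℝ) : ℂ) =
          bandDeriv T (γ t) i * (starRingEnd ℂ) (bandDeriv T (γ t) i) := by
        rw [gradIm, norm_mul, Complex.norm_I, one_mul, RCLike.norm_conj, Complex.mul_conj,
          Complex.normSq_eq_norm_sq]
      rw [h3, h2, gradIm]
      ring
    rw [Finset.sum_congr rfl fun i _ => h1 i, ← Finset.mul_sum, ← Complex.ofReal_sum]
    change -(_ / _) * (gradImNormSq T (γ t) : ℂ) = _
    have : (gradImNormSq T (γ t) : ℂ) ≠ 0 := Complex.ofReal_ne_zero.2 hgrad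
    field_simp
  rw [hsum] at h0
  have h5 : deriv (fun u => (γ u).2) t = Complex.I := by
    refine mul_left_cancel₀ hDE ?_
    linear_combination h0
  rw [← h5]
  exact hdiff.hasDerivAt

/-! ### Energy and `μ` on the ascending manifold; relevance forces a hit -/

namespace AscendingParam

variable {T : Hopping d N} {P : Pt d}

theorem mem_energySurface (A : AscendingParam T P) (hP : P ∈ energySurface T) {x : Eucl d}
    (hx : x ∈ A.domain) : A.toFun x ∈ energySurface T := by
  rcases eq_or_ne x 0 with rfl | hx0
  · rwa [A.map_zero]
  · have hn : 0 < ‖x‖ := norm_pos_iff.2 hx0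
    have hx' : ‖x‖ • ‖x‖⁻¹ • x = x := smul_inv_smul₀ hn.ne' x
    have h := (A.flowLine (‖x‖⁻¹ • x) (norm_smul_inv_norm (𝕜 := ℝ) hx0) ‖x‖
      ⟨hn, by rwa [hx']⟩).1
    simpa only [hx'] using h

/-- The energy at the parameter `x` lies at height `‖x‖` above the saddle point. -/
theorem energy_eq (A : AscendingParam T P) {x : Eucl d} (hx : x ∈ A.domain) :
    (A.toFun x).2 = P.2 + Complex.I * (‖x‖ : ℂ) := by
  rcases eq_or_ne x 0 with rfl | hx0
  · simp [A.map_zero]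
  have hn : 0 < ‖x‖ := norm_pos_iff.2 hx0
  set ξ : Eucl d := ‖x‖⁻¹ • x
  have hx' : ‖x‖ • ξ = x := smul_inv_smul₀ hn.ne' x
  have hmem : ∀ t ∈ Icc (0 : ℝ) ‖x‖, t • ξ ∈ A.domain := by
    intro t ht
    have h1 : t • ξ = (t / ‖x‖) • x := by rw [smul_smul, div_eq_mul_inv]
    rw [h1]
    exact A.starConvex_domain.smul_mem hx (by positivity [ht.1]) (div_le_one_of_le₀ ht.2 hn.le)
  have hcont : ContinuousOn (fun t : ℝ => (A.toFun (t • ξ)).2 - Complex.I * t) (Icc 0 ‖x‖) := by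
    refine ContinuousOn.sub ?_ (by fun_prop)
    exact continuous_snd.comp_continuousOn (A.continuousOn.comp (by fun_prop) hmem)
  have hder : ∀ t ∈ Ioc (0 : ℝ) ‖x‖,
      HasDerivAt (fun t : ℝ => (A.toFun (t • ξ)).2 - Complex.I * t) 0 t := by
    intro t ht
    have hopen : IsOpen {t : ℝ | 0 < t ∧ t • ξ ∈ A.domain} :=
      isOpen_Ioi.inter (A.isOpen_domain.preimage (by fun_prop))
    have h1 := (A.flowLine ξ (norm_smul_inv_norm (𝕜 := ℝ) hx0)).hasDerivAt_energy
      (hopen.mem_nhds ⟨ht.1, hmem t ⟨ht.1.le, ht.2⟩⟩)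
    have h2 := h1.fun_sub ((Complex.ofRealCLM.hasDerivAt (x := t)).const_mul Complex.I)
    simp only [Complex.ofRealCLM_apply, Complex.ofReal_one, mul_one, sub_self] at h2
    exact h2
  -- At time `0` only continuity is available, while the criterion needs a derivative at the left
  -- endpoint; hence the reversed time `‖x‖ - s`.
  have hconst := constant_of_has_deriv_right_zero
    (f := fun s : ℝ => (A.toFun ((‖x‖ - s) • ξ)).2 - Complex.I * ((‖x‖ - s : ℝ) : ℂ))
    (a := 0) (b := ‖x‖)
    (hcont.comp (f := fun s : ℝ => ‖x‖ - s) (by fun_prop)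
      fun s hs => ⟨sub_nonneg.2 hs.2, sub_le_self _ hs.1⟩)
    (fun s hs => by
      have h := (hder (‖x‖ - s) ⟨sub_pos.2 hs.2, sub_le_self _ hs.1⟩).scomp s
        ((hasDerivAt_id s).const_sub ‖x‖)
      rw [smul_zero] at h
      exact h.hasDerivWithinAt) ‖x‖ ⟨hn.le, le_rfl⟩
  simp only [sub_self, sub_zero, hx', zero_smul, A.map_zero, Complex.ofReal_zero, mul_zero] at hconst
  linear_combination -hconst

theorem continuousAt_mu_zero (A : AscendingParam T P) (hP : P ∈ energySurface T) :
    ContinuousAt A.mu 0 := by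
  have hc : ContinuousAt A.toFun 0 := A.continuousOn.continuousAt (A.isOpen_domain.mem_nhds A.zero_mem)
  refine (PiLp.continuous_toLp 2 _).continuousAt.comp (continuousAt_pi.2 fun i => ?_)
  refine ContinuousAt.log ?_ ?_
  · exact ((continuous_apply i).comp continuous_fst).norm.continuousAt.comp hc
  · rw [A.map_zero]
    exact norm_ne_zero_iff.2 (hP.1 i)

theorem contDiffAt_mu (A : AscendingParam T P) (hP : P ∈ energySurface T) {x : Eucl d}
    (hx : x ∈ A.domain) (hx0 : x ≠ 0) : ContDiffAt ℝ 1 A.mu x := by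
  have hc : ContDiffAt ℝ 1 A.toFun x :=
    (A.smooth.contDiffAt ((A.isOpen_domain.sdiff isClosed_singleton).mem_nhds ⟨hx, hx0⟩)).of_le
      (by exact_mod_cast le_top)
  refine (contDiffAt_euclidean).2 fun i => ?_
  have hne : (A.toFun x).1 i ≠ 0 := (A.mem_energySurface hP hx).1 i
  have h1 : ContDiffAt ℝ 1 (fun y => (A.toFun y).1 i) x :=
    contDiffAt_pi.1 (contDiffAt_fst.comp x hc) i
  exact (h1.norm ℝ hne).log (norm_ne_zero_iff.2 hne)

theorem mem_brillouinZone_of_mu_eq_zero (A : AscendingParam T P) (hP : P ∈ energySurface T)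
    {x : Eucl d} (hx : x ∈ A.domain) (h : A.mu x = 0) : A.toFun x ∈ brillouinZone T := by
  have hsurf := A.mem_energySurface hP hx
  refine ⟨hsurf, fun i => ?_⟩
  have h1 : Real.log ‖(A.toFun x).1 i‖ = 0 := congrArg (fun v : Eucl d => v i) h
  exact Real.eq_one_of_pos_of_log_eq_zero (norm_pos_iff.2 (hsurf.1 i)) h1

end AscendingParam

/-- Without hits the signed sum is empty, and `μ` has no zero on the closed ball of radius `t`, its
centre included, so the winding number vanishes as well. -/
theorem IsRelevant.exists_hit {T : Hopping d N} {P : Pt d} (hP : P ∈ energySurface T)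
    (h : IsRelevant T P) : ∃ A : AscendingParam T P, A.hits.Nonempty := by
  obtain ⟨A, ⟨-, hw⟩ | ⟨t, ⟨ht, hball, -⟩, hw⟩⟩ := h
  · refine ⟨A, nonempty_iff_ne_empty.2 fun he => hw ?_⟩
    simp [AscendingParam.hitWeight, he]
  · refine ⟨A, by_contra fun hne => hw ?_⟩
    refine windingNumber_eq_zero_of_nonvanishing ht (A.continuousAt_mu_zero hP)
      (fun x hx => A.contDiffAt_mu hP (hball hx)) fun x hx h0 => hne ⟨x, hball hx, ?_⟩
    exact A.mem_brillouinZone_of_mu_eq_zero hP (hball hx) h0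

theorem IsRelevant.exists_mem_pbcSpectrum {T : Hopping d N} {P : Pt d} (hP : P ∈ energySurface T)
    (h : IsRelevant T P) : ∃ t : ℝ, 0 ≤ t ∧ P.2 + Complex.I * (t : ℂ) ∈ pbcSpectrum T := by
  obtain ⟨A, x, hx, hBZ⟩ := h.exists_hit hP
  exact ⟨‖x‖, norm_nonneg x, A.toFun x, hBZ, A.energy_eq hx⟩

/-! ### Compactness of the Brillouin zone and the maximum of `Im E` -/

theorem ne_zero_of_norm_eq_one {z : Fin d → ℂ} (hz : ∀ i, ‖z i‖ = 1) (i : Fin d) : z i ≠ 0 :=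
  norm_ne_zero_iff.1 (by rw [hz i]; exact one_ne_zero)

theorem mem_spectrum_iff_charDet_eq_zero (T : Hopping d N) (P : Pt d) :
    P.2 ∈ spectrum ℂ (hamiltonian T P.1) ↔ charDet T P = 0 := by
  rw [spectrum.mem_iff, Matrix.isUnit_iff_isUnit_det, isUnit_iff_ne_zero, not_not, charDet,
    Algebra.algebraMap_eq_smul_one]

-- Energies are eigenvalues of `H(z)`, hence bounded through its norm, which is bounded on the
-- compact torus. The choice of matrix norm plays no role outside this proof.
attribute [local instance] Matrix.linftyOpNormedRing Matrix.linftyOpNormedAlgebra in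
theorem exists_norm_le_of_mem_brillouinZone (T : Hopping d N) :
    ∃ C : ℝ, ∀ P ∈ brillouinZone T, ‖P.2‖ ≤ C := by
  have hK : IsCompact (univ.pi fun _ : Fin d => sphere (0 : ℂ) 1) :=
    isCompact_univ_pi fun _ => isCompact_sphere 0 1
  have hcont : ContinuousOn (hamiltonian T) (univ.pi fun _ : Fin d => sphere (0 : ℂ) 1) := by
    intro z hz
    have hz1 : ∀ i, ‖z i‖ = 1 := fun i => mem_sphere_zero_iff_norm.1 (hz i (mem_univ i))
    refine ContinuousAt.continuousWithinAt (continuousAt_pi.2 fun a => continuousAt_pi.2 fun b => ?_)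
    exact (differentiableAt_hamiltonian_apply T (ne_zero_of_norm_eq_one hz1) a b).continuousAt
  obtain ⟨C, hC⟩ := hK.exists_bound_of_continuousOn hcont
  refine ⟨C * ‖(1 : Matrix (Fin N) (Fin N) ℂ)‖, fun P hP => ?_⟩
  refine (spectrum.norm_le_norm_mul_of_mem
    ((mem_spectrum_iff_charDet_eq_zero T P).2 hP.1.2)).trans ?_
  gcongr
  exact hC _ fun i _ => mem_sphere_zero_iff_norm.2 (hP.2 i)

theorem isCompact_brillouinZone (T : Hopping d N) : IsCompact (brillouinZone T) := by
  obtain ⟨C, hC⟩ := exists_norm_le_of_mem_brillouinZone T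
  have hK : IsCompact ((univ.pi fun _ : Fin d => sphere (0 : ℂ) 1) ×ˢ closedBall (0 : ℂ) C) :=
    (isCompact_univ_pi fun _ => isCompact_sphere 0 1).prod (isCompact_closedBall 0 C)
  have hn : ∀ P ∈ (univ.pi fun _ : Fin d => sphere (0 : ℂ) 1) ×ˢ closedBall (0 : ℂ) C,
      ∀ i, ‖P.1 i‖ = 1 := fun P hP i => mem_sphere_zero_iff_norm.1 (hP.1 i (mem_univ i))
  have hcont : ContinuousOn (charDet T)
      ((univ.pi fun _ : Fin d => sphere (0 : ℂ) 1) ×ˢ closedBall (0 : ℂ) C) := fun P hP =>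
    (differentiableAt_charDet T (ne_zero_of_norm_eq_one (hn P hP))).continuousAt.continuousWithinAt
  have hclosed := hcont.preimage_isClosed_of_isClosed hK.isClosed (isClosed_singleton (x := (0 : ℂ)))
  have heq : brillouinZone T =
      (univ.pi fun _ : Fin d => sphere (0 : ℂ) 1) ×ˢ closedBall (0 : ℂ) C ∩ charDet T ⁻¹' {0} := by
    ext P
    constructor
    · intro hP
      exact ⟨⟨fun i _ => mem_sphere_zero_iff_norm.2 (hP.2 i), mem_closedBall_zero_iff.2 (hC P hP)⟩,
        hP.1.2⟩
    · rintro ⟨hP, h0⟩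
      exact ⟨⟨ne_zero_of_norm_eq_one (hn P hP), h0⟩, hn P hP⟩
  rw [heq]
  exact hK.of_isClosed_subset hclosed inter_subset_left

/-- With at least one band, `H(1, …, 1)` has an eigenvalue. -/
theorem brillouinZone_nonempty (hN : 1 ≤ N) (T : Hopping d N) : (brillouinZone T).Nonempty := by
  have : Nonempty (Fin N) := ⟨⟨0, hN⟩⟩
  obtain ⟨E, hE⟩ := spectrum.nonempty_of_isAlgClosed_of_finiteDimensional ℂ
    (hamiltonian T fun _ => 1)
  refine ⟨(fun _ => 1, E), ⟨fun _ => one_ne_zero, ?_⟩, fun _ => norm_one⟩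
  exact (mem_spectrum_iff_charDet_eq_zero T (fun _ => 1, E)).1 hE

theorem exists_isGreatest_im_pbcSpectrum (hN : 1 ≤ N) (T : Hopping d N) :
    ∃ m : ℝ, IsGreatest (Complex.im '' pbcSpectrum T) m :=
  (((isCompact_brillouinZone T).image continuous_snd).image Complex.continuous_im).exists_isGreatest
    (((brillouinZone_nonempty hN T).image _).image _)

end LatticeModel
end

theorem mainTheorem5 {d N : ℕ} (hd : 1 ≤ d) (hN : 1 ≤ N) (T : LatticeModel.Hopping d N) :
    (∀ P : LatticeModel.Pt d, LatticeModel.IsSaddlePoint T P → LatticeModel.IsRelevant T P →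
      ∃ t : ℝ, 0 ≤ t ∧ P.2 + Complex.I * (t : ℂ) ∈ LatticeModel.pbcSpectrum T) ∧
    (∃ m : ℝ, IsGreatest (Complex.im '' LatticeModel.pbcSpectrum T) m ∧
      ∀ P : LatticeModel.Pt d, LatticeModel.IsSaddlePoint T P → LatticeModel.IsRelevant T P →
        P.2.im ≤ m) := by
  refine ⟨fun P hP hrel => hrel.exists_mem_pbcSpectrum hP.1, ?_⟩
  obtain ⟨m, hm⟩ := LatticeModel.exists_isGreatest_im_pbcSpectrum hN T
  refine ⟨m, hm, fun P hP hrel => ?_⟩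
  obtain ⟨t, ht, hmem⟩ := hrel.exists_mem_pbcSpectrum hP.1
  have h := hm.2 ⟨_, hmem, rfl⟩
  simp at h
  linarith
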